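/- Let $\mathcal H$ be a separable complex Hilbert space with inner product $\langle\cdot,\cdot\rangle$ linear in the second argument. A linear operator $A$ with domain $D(A)\subseteq\mathcal H$ is called dissipative if $\operatorname{Im}\langle x,Ax\rangle\ge 0$ for all $x\in D(A)$, and maximally dissipative if it is closed, dissipative and has no proper dissipative extension. Let $A$ be maximally dissipative on $\mathcal H$, let $B\ge 0$ be a bounded nonnegative self-adjoint operator on $\mathcal H$, let $\lambda>0$ and $\phi\in\mathcal H$. For $t\in\mathbb R$ let $T_t=A+tB+i\lambda B$, with domain $D(A)$. Suppose that the matrix elements below are defined, i.e. that for every $t\in\mathbb R$ the operator $T_t$ is injective and $B^{1/2}\phi$ lies in its range, the domain of $T_t^{-1}$ (this holds for every $\phi$ if each $T_t$ has a bounded everywhere defined inverse). Then, for every $n\in\mathbb Z$, the function $y\mapsto\operatorname{Im}\langle B^{1/2}\phi,(A+(n+y)B+i\lambda B)^{-1}B^{1/2}\phi\rangle$ is bounded on $[0,1]$, and $$\sum_{n\in\mathbb Z}\ \sup_{y\in[0,1]}\Bigl(-\operatorname{Im}\bigl\langle B^{1/2}\phi,\,(A+(n+y)B+i\lambda B)^{-1}B^{1/2}\phi\bigr\rangle\Bigr)\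 \le\ \pi\Bigl(1+\frac1\lambda\Bigr)\|\phi\|^2 ,$$ $$-\sum_{n\in\mathbb Z}\ \sup_{y\in[0,1]}\operatorname{Im}\bigl\langle B^{1/2}\phi,\,(A+(n+y)B+i\lambda B)^{-1}B^{1/2}\phi\bigr\rangle\ \le\ \pi\Bigl(1+\frac1\lambda\Bigr)\|\phi\|^2 ,$$ where both series converge. -/

import Mathlib

namespace SpectralAveraging

variable {H : Type*} [NormedAddCommGroup H] [InnerProductSpace ℂ H]

/-- A (possibly unbounded) operator `A` is dissipative when `Im A ≥ 0`, that is
`Im ⟨x, A x⟩ ≥ 0` for every `x` in its domain (the inner product is linear in the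
second argument). -/
def IsDissipative (A : H →ₗ.[ℂ] H) : Prop :=
  ∀ x : A.domain, 0 ≤ (inner ℂ (x : H) (A x)).im

/-- A closed operator is maximally dissipative when it is dissipative and has no proper
dissipative extension. -/
structure IsMaximallyDissipative (A : H →ₗ.[ℂ] H) : Prop where
  isClosed : A.IsClosed
  isDissipative : IsDissipative A
  eq_of_le : ∀ A' : H →ₗ.[ℂ] H, IsDissipative A' → A ≤ A' → A' = A

/-- The operator `A + t B + i l B`, with the domain of `A`. -/
noncomputable def perturbed (A : H →ₗ.[ℂ] H) (B : H →L[ℂ] H) (l t : ℝ) : H →ₗ.[ℂ] H :=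
  (((t : ℂ) • B + (Complex.I * (l : ℂ)) • B : H →L[ℂ] H) : H →ₗ[ℂ] H) +ᵥ A

/-- The matrix element `⟨v, T⁻¹ v⟩` of the inverse of an operator `T` (whose domain is the range
of `T`), for a vector `v` in the domain of `T⁻¹`. -/
noncomputable def inverseElement (T : H →ₗ.[ℂ] H) (v : H) (hv : v ∈ T.inverse.domain) : ℂ :=
  inner ℂ v (T.inverse ⟨v, hv⟩)

end SpectralAveraging

/-! Put `v = B^{1/2} φ`. For `ε > 0` the function `f(z) = -⟨v, (A + zB + iε)⁻¹ v⟩` is holomorphic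
and bounded on the closed upper half-plane, with `Im f ≥ 0`. By the Poisson formula, `π Im f(t +
iλ)` is the integral over the real line of `Im f(s)` against the kernel `P(s - t) = λ / ((s - t)² +
λ²)`. Dissipativity and Cauchy–Schwarz give `Im f(iy) ≤ ‖φ‖² / y`, so the density `Im f` has mass at
most `π‖φ‖²` on every interval `[-R, R]`, whatever `ε`. With one point `t n` in each `[n, n + 1]`,
the kernels satisfy `∑ P(s - t n) ≤ π + 3/λ ≤ π(1 + 1/λ)`: three nearby cells cost `1/λ` each, the
others at most the total integral `π`. Hence `∑ Im f(t n + iλ) ≤ π(1 + 1/λ)‖φ‖²` (`sum_im_le`).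
Maximality makes the regularized equation solvable (`exists_apply_add_eq`) and lets `ε → 0` when `A
+ tB + iλB` is only injective (`tendsto_regularized`). As the points `t n` are arbitrary, suprema
may be taken cell by cell (`tsum_ciSup_le`). -/

namespace SpectralAveraging

open MeasureTheory Filter Topology

/-! ### Poisson representation in the upper half-plane and sums of Poisson kernels -/

section UpperHalfPlane

/-- The Poisson kernel of the upper half-plane at height `l`, without the factor `1 / π`. -/
noncomputable def poissonKernel (l s : ℝ) : ℝ := l / (s ^ 2 + l ^ 2)

lemma poissonKernel_eq {l : ℝ} (hl : 0 < l) (s : ℝ) :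
    poissonKernel l s = l⁻¹ * (1 + (s / l) ^ 2)⁻¹ := by
  unfold poissonKernel
  field_simp
  ring

lemma poissonKernel_nonneg {l : ℝ} (hl : 0 < l) (s : ℝ) : 0 ≤ poissonKernel l s := by
  unfold poissonKernel
  positivity

lemma poissonKernel_le_inv {l : ℝ} (hl : 0 < l) (s : ℝ) : poissonKernel l s ≤ 1 / l := by
  unfold poissonKernel
  rw [div_le_div_iff₀ (by positivity) hl]
  nlinarith [sq_nonneg s]

lemma poissonKernel_le_of_abs_le {l : ℝ} (hl : 0 < l) {s r : ℝ} (h : |r| ≤ |s|) :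
    poissonKernel l s ≤ poissonKernel l r := by
  unfold poissonKernel
  have := sq_le_sq.2 h
  gcongr

lemma integrable_poissonKernel {l : ℝ} (hl : 0 < l) : Integrable (poissonKernel l) := by
  rw [funext (poissonKernel_eq hl)]
  exact (integrable_inv_one_add_sq.comp_div hl.ne').const_mul _

lemma integral_poissonKernel {l : ℝ} (hl : 0 < l) : ∫ s, poissonKernel l s = Real.pi := by
  rw [funext (poissonKernel_eq hl), integral_const_mul,
    Measure.integral_comp_div (fun x : ℝ => (1 + x ^ 2)⁻¹), integral_univ_inv_one_add_sq,
    abs_of_pos hl, smul_eq_mul, ← mul_assoc, inv_mul_cancel₀ hl.ne', one_mul]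

lemma sub_mul_sub_conj (w : ℂ) (s : ℝ) :
    ((s : ℂ) - w) * (s - starRingEnd ℂ w) = (((s - w.re) ^ 2 + w.im ^ 2 : ℝ) : ℂ) := by
  apply Complex.ext <;> simp [-Complex.ofReal_add, -Complex.ofReal_pow, -Complex.ofReal_sub] <;> ring

/-- A function that is holomorphic on the closed upper half-plane and decays quadratically has
vanishing integral over the real line. -/
lemma tendsto_intervalIntegral_zero_of_decay {g : ℂ → ℂ} {C R₀ : ℝ}
    (hd : DifferentiableOn ℂ g {z | 0 ≤ z.im})
    (hg : ∀ z : ℂ, 0 ≤ z.im → R₀ ≤ ‖z‖ → ‖g z‖ ≤ C / ‖z‖ ^ 2) :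
    Tendsto (fun R : ℝ => ∫ x in (-R)..R, g x) atTop (𝓝 0) := by
  have key : ∀ᶠ R : ℝ in atTop, ‖∫ x in (-R)..R, g x‖ ≤ (4 * |C|) / R := by
    filter_upwards [eventually_ge_atTop R₀, eventually_gt_atTop 0] with R hR hR0
    have hb : ∀ z : ℂ, 0 ≤ z.im → R ≤ ‖z‖ → ‖g z‖ ≤ |C| / R ^ 2 := fun z h1 h2 =>
      (hg z h1 (hR.trans h2)).trans (by gcongr; exact le_abs_self C)
    -- Cauchy on the rectangle with corners `-R` and `R + iR`: the three other sides have total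
    -- length `4R`, and there `‖g‖ ≤ |C| / R²`.
    have hrect := Complex.integral_boundary_rect_eq_zero_of_differentiableOn g
      ((-R : ℝ) : ℂ) (R + R * Complex.I) (hd.mono fun z hz => by
        have := hz.2
        simp [Set.uIcc_of_le hR0.le] at this
        exact this.1)
    simp only [Complex.ofReal_re, Complex.add_re, Complex.mul_re, Complex.I_re, mul_zero,
      Complex.ofReal_im, Complex.I_im, mul_one, sub_self, add_zero, Complex.add_im,
      Complex.mul_im, zero_add, Complex.ofReal_zero, zero_mul, smul_eq_mul] at hrect
    have e1 : ‖∫ x in (-R)..R, g (x + R * Complex.I)‖ ≤ |C| / R ^ 2 * |R - -R| :=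
      intervalIntegral.norm_integral_le_of_norm_le_const fun x _ => hb _ (by simpa using hR0.le) <| by
        simpa [abs_of_pos hR0] using Complex.abs_im_le_norm (x + R * Complex.I)
    have e2 : ‖∫ y in (0 : ℝ)..R, g (R + y * Complex.I)‖ ≤ |C| / R ^ 2 * |R - 0| :=
      intervalIntegral.norm_integral_le_of_norm_le_const fun y hy => by
        rw [Set.uIoc_of_le hR0.le] at hy
        refine hb _ (by simpa using hy.1.le) ?_
        simpa [abs_of_pos hR0] using Complex.abs_re_le_norm (R + y * Complex.I)
    have e3 : ‖∫ y in (0 : ℝ)..R, g ((-R : ℝ) + y * Complex.I)‖ ≤ |C| / R ^ 2 * |R - 0| :=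
      intervalIntegral.norm_integral_le_of_norm_le_const fun y hy => by
        rw [Set.uIoc_of_le hR0.le] at hy
        refine hb _ (by simpa using hy.1.le) ?_
        simpa [abs_of_pos hR0] using Complex.abs_re_le_norm ((-R : ℝ) + y * Complex.I)
    have : ∫ x in (-R)..R, g x = (∫ x in (-R)..R, g (x + R * Complex.I))
        - Complex.I * (∫ y in (0 : ℝ)..R, g (R + y * Complex.I))
        + Complex.I * ∫ y in (0 : ℝ)..R, g ((-R : ℝ) + y * Complex.I) := by
      linear_combination hrect
    rw [this]
    refine (norm_add_le _ _).trans ((add_le_add (norm_sub_le _ _) le_rfl).trans ?_)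
    rw [norm_mul, norm_mul, Complex.norm_I, one_mul, one_mul]
    refine (add_le_add (add_le_add e1 e2) e3).trans (le_of_eq ?_)
    rw [sub_neg_eq_add, sub_zero, abs_of_pos hR0, abs_of_pos (by positivity : 0 < R + R)]
    field_simp
    ring
  exact squeeze_zero_norm' key (tendsto_const_nhds.div_atTop tendsto_id)

/-- The Poisson formula for a bounded holomorphic function on the closed upper half-plane. -/
lemma integral_poissonKernel_mul {f : ℂ → ℂ} {M : ℝ} (hd : DifferentiableOn ℂ f {z | 0 ≤ z.im})
    (hM : ∀ z : ℂ, 0 ≤ z.im → ‖f z‖ ≤ M) {w : ℂ} (hw : 0 < w.im) :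
    ∫ s : ℝ, (poissonKernel w.im (s - w.re) : ℂ) * f s = Real.pi * f w := by
  have hpos : ∀ s : ℝ, 0 < (s - w.re) ^ 2 + w.im ^ 2 := fun s => by positivity
  have hM0 : 0 ≤ M := (norm_nonneg _).trans (hM w hw.le)
  have hconj : ∀ z : ℂ, 0 ≤ z.im → z - starRingEnd ℂ w ≠ 0 := fun z hz h => by
    have := congrArg Complex.im h
    simp at this
    linarith
  have hmeas : Continuous fun s : ℝ => f s := by
    rw [← continuousOn_univ]
    exact hd.continuousOn.comp Complex.continuous_ofReal.continuousOn (by intro s _; simp)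
  have hP : Integrable fun s : ℝ => (poissonKernel w.im (s - w.re) : ℂ) :=
    ((integrable_poissonKernel hw).comp_sub_right w.re).ofReal
  have hPf : Integrable fun s : ℝ => (poissonKernel w.im (s - w.re) : ℂ) * f s :=
    hP.mul_bdd (c := M) hmeas.aestronglyMeasurable (Eventually.of_forall fun s => hM _ (by simp))
  -- Subtracting `f w` removes the pole at `w`, and the other pole, `conj w`, lies in the open lower
  -- half-plane. On the real line `w.im * g` is the Poisson kernel times `f s - f w`.
  set g : ℂ → ℂ := fun z => dslope f w z / (z - starRingEnd ℂ w) with hgdef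
  have hgd : DifferentiableOn ℂ g {z | 0 ≤ z.im} := by
    refine DifferentiableOn.div ?_ (by fun_prop) hconj
    refine (Complex.differentiableOn_dslope ?_).2 hd
    exact mem_of_superset ((isOpen_lt continuous_const Complex.continuous_im).mem_nhds hw)
      fun z (hz : 0 < z.im) => hz.le
  have hslope : ∀ z ≠ w, g z = (f z - f w) / ((z - w) * (z - starRingEnd ℂ w)) := fun z hz => by
    simp only [hgdef, dslope_of_ne f hz, slope_def_field, div_div]
  have hdecay : ∀ z : ℂ, 0 ≤ z.im → 2 * ‖w‖ + 1 ≤ ‖z‖ → ‖g z‖ ≤ (8 * M) / ‖z‖ ^ 2 := by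
    intro z hz hzR
    have hz0 : 0 < ‖z‖ := by linarith [norm_nonneg w]
    have h1 : ‖z‖ / 2 ≤ ‖z - w‖ := by linarith [norm_sub_norm_le z w]
    have h2 : ‖z‖ / 2 ≤ ‖z - starRingEnd ℂ w‖ := by
      have := norm_sub_norm_le z (starRingEnd ℂ w)
      rw [RCLike.norm_conj] at this
      linarith
    have hne : z ≠ w := by rintro rfl; linarith [norm_nonneg z]
    rw [hslope z hne, norm_div, norm_mul]
    calc ‖f z - f w‖ / (‖z - w‖ * ‖z - starRingEnd ℂ w‖)
        ≤ (M + M) / (‖z‖ / 2 * (‖z‖ / 2)) := by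
          gcongr
          exact (norm_sub_le _ _).trans (add_le_add (hM z hz) (hM w hw.le))
      _ = (8 * M) / ‖z‖ ^ 2 := by field_simp; ring
  have hreal : ∀ s : ℝ, (w.im : ℂ) * g s = (poissonKernel w.im (s - w.re) : ℂ) * f s
      - (poissonKernel w.im (s - w.re) : ℂ) * f w := by
    intro s
    have hne : (s : ℂ) ≠ w := by
      rintro h
      have := congrArg Complex.im h
      simp at this
      linarith
    rw [hslope _ hne, sub_mul_sub_conj, poissonKernel]
    push_cast
    ring
  have hint : Integrable fun s : ℝ => (w.im : ℂ) * g s := by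
    simp_rw [hreal]
    exact hPf.sub (hP.mul_const _)
  have h0 : ∫ s : ℝ, (w.im : ℂ) * g s = 0 := by
    refine tendsto_nhds_unique
      (intervalIntegral_tendsto_integral hint tendsto_neg_atTop_atBot tendsto_id) ?_
    have := (tendsto_intervalIntegral_zero_of_decay hgd hdecay).const_mul (w.im : ℂ)
    simpa [intervalIntegral.integral_const_mul] using this
  simp_rw [hreal] at h0
  rw [integral_sub hPf (hP.mul_const _), integral_mul_const, integral_complex_ofReal,
    integral_sub_right_eq_self (poissonKernel w.im), integral_poissonKernel hw, sub_eq_zero] at h0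
  exact h0

/-- Poisson kernels centred at one point in each unit interval have a uniformly bounded sum. -/
lemma sum_poissonKernel_le {l : ℝ} (hl : 0 < l) (S : Finset ℤ) (t : ℤ → ℝ)
    (ht : ∀ n : ℤ, t n ∈ Set.Icc (n : ℝ) (n + 1)) (x : ℝ) :
    ∑ n ∈ S, poissonKernel l (x - t n) ≤ Real.pi + 3 / l := by
  set m : ℤ := ⌊x⌋ with hm
  have hm1 : (m : ℝ) ≤ x := Int.floor_le x
  have hm2 : x < m + 1 := Int.lt_floor_add_one x
  -- For cells outside `N`, `k` shifts by one towards `x`, so every point of `I (k n)` is at least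
  -- as close to `x` as `t n`. The shifted cells are still disjoint: those from the left stay below
  -- `m`, those from the right above it.
  let N : Finset ℤ := {m - 1, m, m + 1}
  let k : ℤ → ℤ := fun n => if m < n then n - 1 else n + 1
  let I : ℤ → Set ℝ := fun n => Set.Ioc (n : ℝ) (n + 1)
  have hnear : ∑ n ∈ S ∩ N, poissonKernel l (x - t n) ≤ 3 / l := by
    calc ∑ n ∈ S ∩ N, poissonKernel l (x - t n) ≤ ∑ n ∈ S ∩ N, 1 / l :=
          Finset.sum_le_sum fun n _ => poissonKernel_le_inv hl _
      _ = ((S ∩ N).card : ℝ) * (1 / l) := by rw [Finset.sum_const, nsmul_eq_mul]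
      _ ≤ 3 * (1 / l) := by
          gcongr
          exact_mod_cast (Finset.card_le_card Finset.inter_subset_right).trans Finset.card_le_three
      _ = 3 / l := by ring
  have hP : Integrable fun s : ℝ => poissonKernel l (s - x) :=
    (integrable_poissonKernel hl).comp_sub_right x
  have hfar : ∑ n ∈ S \ N, poissonKernel l (x - t n) ≤ Real.pi := by
    have hN : ∀ n ∈ S \ N, n < m - 1 ∨ m + 1 < n := fun n hn => by
      simp only [N, Finset.mem_sdiff, Finset.mem_insert, Finset.mem_singleton] at hn
      omega
    have hle : ∀ n ∈ S \ N, poissonKernel l (x - t n) ≤ ∫ s in I (k n), poissonKernel l (s - x) := by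
      intro n hn
      have h1 : ∫ _ in I (k n), poissonKernel l (x - t n) = poissonKernel l (x - t n) := by
        simp [I]
      rw [← h1]
      refine setIntegral_mono_on (by simp [I]) hP.integrableOn measurableSet_Ioc ?_
      intro s hs
      apply poissonKernel_le_of_abs_le hl
      obtain ⟨ht1, ht2⟩ := ht n
      obtain ⟨hs1, hs2⟩ := hs
      rcases hN n hn with h | h
      · have hk : k n = n + 1 := if_neg (by omega)
        rw [hk] at hs1 hs2
        push_cast at hs1 hs2
        have : (n : ℝ) + 2 ≤ m := by exact_mod_cast (by omega : n + 2 ≤ m)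
        rw [abs_of_nonpos (by linarith), abs_of_nonneg (by linarith)]
        linarith
      · have hk : k n = n - 1 := if_pos (by omega)
        rw [hk] at hs1 hs2
        push_cast at hs1 hs2
        have : (m : ℝ) + 2 ≤ n := by exact_mod_cast (by omega : m + 2 ≤ n)
        rw [abs_of_nonneg (by linarith), abs_of_nonpos (by linarith)]
        linarith
    refine (Finset.sum_le_sum hle).trans ?_
    rw [← integral_biUnion_finset (S \ N) (s := fun n => I (k n))
      (fun _ _ => measurableSet_Ioc) ?_ (fun _ _ => hP.integrableOn)]
    · refine (setIntegral_le_integral hP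
        (Eventually.of_forall fun s => poissonKernel_nonneg hl _)).trans ?_
      rw [integral_sub_right_eq_self (poissonKernel l), integral_poissonKernel hl]
    · intro a ha b hb hab
      have hkab : k a ≠ k b := by
        have := hN a ha
        have := hN b hb
        simp only [k]
        split_ifs <;> omega
      exact Set.pairwise_disjoint_Ioc_intCast ℝ hkab
  rw [← Finset.sum_inter_add_sum_sdiff S N]
  linarith

/-- Averaging of a bounded holomorphic function with nonnegative imaginary part whose representing
measure has total mass at most `K`. -/
lemma sum_im_le {f : ℂ → ℂ} {M K l : ℝ} (hl : 0 < l)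
    (hd : DifferentiableOn ℂ f {z | 0 ≤ z.im}) (hM : ∀ z : ℂ, 0 ≤ z.im → ‖f z‖ ≤ M)
    (hpos : ∀ z : ℂ, 0 ≤ z.im → 0 ≤ (f z).im)
    (hK : ∀ y : ℝ, 0 < y → (f (y * Complex.I)).im ≤ K / y)
    (S : Finset ℤ) (t : ℤ → ℝ) (ht : ∀ n : ℤ, t n ∈ Set.Icc (n : ℝ) (n + 1)) :
    ∑ n ∈ S, (f (t n + l * Complex.I)).im ≤ (Real.pi + 3 / l) * K := by
  have hcont : Continuous fun s : ℝ => (f s).im := by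
    refine Complex.continuous_im.comp ?_
    rw [← continuousOn_univ]
    exact hd.continuousOn.comp Complex.continuous_ofReal.continuousOn (by intro s _; simp)
  have hint : ∀ y, 0 < y → ∀ a, Integrable fun s : ℝ => poissonKernel y (s - a) * (f s).im :=
    fun y hy a => ((integrable_poissonKernel hy).comp_sub_right a).mul_bdd (c := M)
      hcont.aestronglyMeasurable (Eventually.of_forall fun s =>
        (Complex.abs_im_le_norm _).trans (hM _ (by simp)))
  have hpoisson : ∀ y, 0 < y → ∀ a : ℝ, ∫ s : ℝ, poissonKernel y (s - a) * (f s).im =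
      Real.pi * (f (a + y * Complex.I)).im := by
    intro y hy a
    have h := integral_poissonKernel_mul hd hM (w := a + y * Complex.I) (by simpa using hy)
    simp only [Complex.add_re, Complex.ofReal_re, Complex.mul_re, Complex.I_re, mul_zero,
      Complex.ofReal_im, Complex.I_im, mul_one, sub_self, add_zero, Complex.add_im,
      Complex.mul_im, zero_add] at h
    have hi : Integrable fun s : ℝ => (poissonKernel y (s - a) : ℂ) * f s := by
      refine (((integrable_poissonKernel hy).comp_sub_right a).ofReal).mul_bdd (c := M) ?_
        (Eventually.of_forall fun s => hM _ (by simp))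
      refine Continuous.aestronglyMeasurable ?_
      rw [← continuousOn_univ]
      exact hd.continuousOn.comp Complex.continuous_ofReal.continuousOn (by intro s _; simp)
    have h2 := congrArg Complex.im h
    rw [Complex.im_ofReal_mul] at h2
    rw [← h2]
    have := integral_im hi
    simpa using this
  -- The mass is read off as `y → ∞`: `y` times the kernel at height `y` is at least `1 / (1 + (R /
  -- y)²)` on `[-R, R]`, while `y * (f (iy)).im ≤ K`.
  have hmass : ∀ R : ℝ, 0 ≤ R → ∫ s in (-R)..R, (f s).im ≤ Real.pi * K := by
    intro R hR
    have hb : ∀ᶠ y : ℝ in atTop, ∫ s in (-R)..R, (f s).im ≤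
        (1 + (R / y) ^ 2) * (Real.pi * K) := by
      filter_upwards [eventually_gt_atTop 0] with y hy
      have h1 : ∫ s in (-R)..R, (f s).im ≤
          ∫ s in (-R)..R, (1 + (R / y) ^ 2) * y * (poissonKernel y (s - 0) * (f s).im) := by
        refine intervalIntegral.integral_mono_on (by linarith) (hcont.intervalIntegrable _ _)
          ((hint y hy 0).const_mul _).intervalIntegrable fun s hs => ?_
        have hs2 : s ^ 2 ≤ R ^ 2 := sq_le_sq.2 (by rw [abs_of_nonneg hR]; exact abs_le.2 hs)
        have : 1 ≤ (1 + (R / y) ^ 2) * y * poissonKernel y (s - 0) := by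
          rw [poissonKernel, sub_zero]
          have : (1 + (R / y) ^ 2) * y * (y / (s ^ 2 + y ^ 2)) = (y ^ 2 + R ^ 2) / (s ^ 2 + y ^ 2) := by
            field_simp
          rw [this, le_div_iff₀ (by positivity)]
          linarith
        rw [← mul_assoc]
        exact le_mul_of_one_le_left (hpos _ (by simp)) this
      have h2 : ∫ s in (-R)..R, poissonKernel y (s - 0) * (f s).im ≤
          ∫ s : ℝ, poissonKernel y (s - 0) * (f s).im := by
        rw [intervalIntegral.integral_of_le (by linarith)]
        exact setIntegral_le_integral (hint y hy 0) (Eventually.of_forall fun s =>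
          mul_nonneg (poissonKernel_nonneg hy _) (hpos _ (by simp)))
      rw [hpoisson y hy 0] at h2
      have h3 := hK y hy
      simp only [Complex.ofReal_zero, zero_add] at h2
      rw [intervalIntegral.integral_const_mul] at h1
      have h4 : Real.pi * (f (y * Complex.I)).im ≤ Real.pi * (K / y) := by gcongr
      calc _ ≤ _ := h1
        _ ≤ (1 + (R / y) ^ 2) * y * (Real.pi * (K / y)) := by
          gcongr
          exact h2.trans h4
        _ = _ := by field_simp
    have hlim : Tendsto (fun y : ℝ => (1 + (R / y) ^ 2) * (Real.pi * K)) atTop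
        (𝓝 ((1 + 0 ^ 2) * (Real.pi * K))) :=
      (((tendsto_const_nhds.div_atTop tendsto_id).pow 2).const_add 1).mul_const _
    simpa using ge_of_tendsto hlim hb
  have hsumint : Integrable fun s : ℝ => ∑ n ∈ S, poissonKernel l (s - t n) * (f s).im :=
    integrable_finsetSum _ fun n _ => hint l hl (t n)
  have htot : ∫ s : ℝ, ∑ n ∈ S, poissonKernel l (s - t n) * (f s).im =
      Real.pi * ∑ n ∈ S, (f (t n + l * Complex.I)).im := by
    rw [integral_finsetSum _ fun n _ => hint l hl (t n), Finset.mul_sum]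
    exact Finset.sum_congr rfl fun n _ => hpoisson l hl (t n)
  have hbound : ∫ s : ℝ, ∑ n ∈ S, poissonKernel l (s - t n) * (f s).im ≤
      (Real.pi + 3 / l) * (Real.pi * K) := by
    -- The mass bound is known on bounded intervals only, so the kernel sum is bounded on `[-R, R]`
    -- before `R → ∞`.
    refine le_of_tendsto
      (intervalIntegral_tendsto_integral hsumint tendsto_neg_atTop_atBot tendsto_id) ?_
    filter_upwards [eventually_ge_atTop 0] with R hR
    calc ∫ s in (-R)..R, ∑ n ∈ S, poissonKernel l (s - t n) * (f s).im
        ≤ ∫ s in (-R)..R, (Real.pi + 3 / l) * (f s).im := by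
          refine intervalIntegral.integral_mono_on (by linarith) hsumint.intervalIntegrable
            ((hcont.intervalIntegrable _ _).const_mul _) fun s _ => ?_
          rw [← Finset.sum_mul]
          exact mul_le_mul_of_nonneg_right (sum_poissonKernel_le hl S t ht s) (hpos _ (by simp))
      _ ≤ (Real.pi + 3 / l) * (Real.pi * K) := by
          rw [intervalIntegral.integral_const_mul]
          have := Real.pi_pos
          gcongr
          exact hmass R hR
  rw [htot] at hbound
  have := Real.pi_pos
  nlinarith

end UpperHalfPlane

end SpectralAveraging

namespace SpectralAveraging

open Filter Topology

/-! ### Maximally dissipative operators: solvability, dense range, regularization -/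

section Dissipative

variable {H : Type*} [NormedAddCommGroup H] [InnerProductSpace ℂ H]

lemma IsDissipative.im_inner_add_nonneg {A : H →ₗ.[ℂ] H} (hA : IsDissipative A) {G : H →L[ℂ] H}
    {c : ℝ} (hG : ∀ x, c * ‖x‖ ^ 2 ≤ (inner ℂ x (G x)).im) (x : A.domain) :
    c * ‖(x : H)‖ ^ 2 ≤ (inner ℂ (x : H) (A x + G x)).im := by
  rw [inner_add_right, Complex.add_im]
  linarith [hA x, hG x]

/-- Cauchy–Schwarz against the lower bound for the imaginary part. This is the resolvent estimate
behind uniqueness, closed range and all later error bounds. -/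
lemma IsDissipative.norm_le {A : H →ₗ.[ℂ] H} (hA : IsDissipative A) {G : H →L[ℂ] H}
    {c : ℝ} (hG : ∀ x, c * ‖x‖ ^ 2 ≤ (inner ℂ x (G x)).im) (x : A.domain) :
    c * ‖(x : H)‖ ≤ ‖A x + G x‖ := by
  rcases eq_or_ne (x : H) 0 with h | h
  · simp [h]
  have h1 := hA.im_inner_add_nonneg hG x
  have h2 := (Complex.im_le_norm _).trans (norm_inner_le_norm (𝕜 := ℂ) (x : H) (A x + G x))
  have : 0 < ‖(x : H)‖ := norm_pos_iff.2 h
  nlinarith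

lemma im_inner_add_smul_I {G : H →L[ℂ] H} (hG : ∀ x, 0 ≤ (inner ℂ x (G x)).im) (ε : ℝ) (x : H) :
    ε * ‖x‖ ^ 2 ≤ (inner ℂ x ((G + (ε * Complex.I) • ContinuousLinearMap.id ℂ H) x)).im := by
  simp only [add_apply, smul_apply,
    ContinuousLinearMap.id_apply, inner_add_right, inner_smul_right, inner_self_eq_norm_sq_to_K]
  have := hG x
  simp [← Complex.ofReal_pow]
  linarith

variable [CompleteSpace H]

/-- A vector orthogonal to the range of `A + G`, where `A` is maximally dissipative and `G` is
bounded and dissipative, lies in the domain of `A`. -/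
lemma IsMaximallyDissipative.mem_domain_of_orthogonal {A : H →ₗ.[ℂ] H}
    (hA : IsMaximallyDissipative A) {G : H →L[ℂ] H} (hG : ∀ x, 0 ≤ (inner ℂ x (G x)).im) {w : H}
    (hw : ∀ x : A.domain, inner ℂ w (A x + G x) = 0) : w ∈ A.domain := by
  by_contra hmem
  -- Extending `A` by `w ↦ -G* w` stays dissipative: orthogonality makes the two cross terms add up
  -- to a real number, and the `w` term contributes `|c|² Im ⟨w, G w⟩ ≥ 0`. Maximality then excludes
  -- `w ∉ A.domain`.
  set q : H := -(ContinuousLinearMap.adjoint G w) with hq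
  have hle : A ≤ A.supSpanSingleton w q hmem := by
    unfold LinearPMap.supSpanSingleton
    exact LinearPMap.left_le_sup _ _ _
  have hdiss : IsDissipative (A.supSpanSingleton w q hmem) := by
    rintro ⟨z, hz⟩
    obtain ⟨x, hx, y, hy, rfl⟩ := Submodule.mem_sup.1 hz
    obtain ⟨c, rfl⟩ := Submodule.mem_span_singleton.1 hy
    rw [LinearPMap.supSpanSingleton_apply_mk A w q hmem x hx c]
    have h1 := hA.isDissipative ⟨x, hx⟩
    have h2 : inner ℂ w (A ⟨x, hx⟩) = -inner ℂ w (G x) := by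
      have := hw ⟨x, hx⟩
      rw [inner_add_right] at this
      exact eq_neg_of_add_eq_zero_left this
    have h3 : inner ℂ x q = -(starRingEnd ℂ (inner ℂ w (G x))) := by
      rw [hq, inner_neg_right, ContinuousLinearMap.adjoint_inner_right, inner_conj_symm]
    have h4 : (inner ℂ w q).im = (inner ℂ w (G w)).im := by
      rw [hq, inner_neg_right, ContinuousLinearMap.adjoint_inner_right, ← inner_conj_symm,
        Complex.neg_im, Complex.conj_im, neg_neg]
    simp only [RingHom.id_apply, inner_add_left, inner_add_right, inner_smul_left,
      inner_smul_right, h2, h3]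
    have h5 := hG w
    rw [← h4] at h5
    simp only [Complex.add_im, Complex.add_re, Complex.mul_im, Complex.mul_re, Complex.neg_im, Complex.neg_re,
      Complex.conj_re, Complex.conj_im] at h1 ⊢
    nlinarith [mul_nonneg (add_nonneg (sq_nonneg c.re) (sq_nonneg c.im)) h5]
  have heq := hA.eq_of_le _ hdiss hle
  apply hmem
  have : w ∈ (A.supSpanSingleton w q hmem).domain :=
    Submodule.mem_sup_right (Submodule.mem_span_singleton_self w)
  rwa [heq] at this

/-- `A + G` is surjective when `A` is maximally dissipative and `G` is bounded and strictly
dissipative. -/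
lemma IsMaximallyDissipative.exists_apply_add_eq {A : H →ₗ.[ℂ] H}
    (hA : IsMaximallyDissipative A) {G : H →L[ℂ] H} {c : ℝ} (hc : 0 < c)
    (hG : ∀ x, c * ‖x‖ ^ 2 ≤ (inner ℂ x (G x)).im) (v : H) : ∃ x : A.domain, A x + G x = v := by
  -- On the graph, complete because `A` is closed, `A + G` becomes a bounded operator; being bounded
  -- below with dense range, it is onto.
  have : CompleteSpace A.graph := hA.isClosed.completeSpace_coe
  let g : A.graph →L[ℂ] H := (ContinuousLinearMap.snd ℂ H H + G.comp (ContinuousLinearMap.fst ℂ H H)).comp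
    A.graph.subtypeL
  have hg : ∀ x : A.domain, g ⟨(x, A x), A.mem_graph x⟩ = A x + G x := fun x => rfl
  have hgraph : ∀ p : A.graph, ∃ x : A.domain, p = ⟨(x, A x), A.mem_graph x⟩ := by
    rintro ⟨⟨a, b⟩, h⟩
    obtain ⟨x, rfl, rfl⟩ := A.mem_graph_iff.1 h
    exact ⟨x, rfl⟩
  have hanti : ∃ K, AntilipschitzWith K g := by
    refine ⟨⟨c⁻¹ + 1 + ‖G‖ * c⁻¹, by positivity⟩, g.antilipschitz_of_bound fun p => ?_⟩
    obtain ⟨x, rfl⟩ := hgraph p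
    rw [hg]
    have h1 : ‖(x : H)‖ ≤ c⁻¹ * ‖A x + G x‖ := by
      rw [← div_eq_inv_mul, le_div_iff₀ hc, mul_comm]
      exact hA.isDissipative.norm_le hG x
    have h2 : ‖A x‖ ≤ ‖A x + G x‖ + ‖G‖ * (c⁻¹ * ‖A x + G x‖) := by
      calc ‖A x‖ = ‖(A x + G x) - G x‖ := by rw [add_sub_cancel_right]
        _ ≤ ‖A x + G x‖ + ‖G x‖ := norm_sub_le _ _
        _ ≤ _ := by
          gcongr
          exact (G.le_opNorm x).trans (by gcongr)
    have h3 : 0 ≤ ‖G‖ * (c⁻¹ * ‖A x + G x‖) := by positivity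
    have h4 : 0 ≤ c⁻¹ * ‖A x + G x‖ := by positivity
    change max ‖(x : H)‖ ‖A x‖ ≤ (c⁻¹ + 1 + ‖G‖ * c⁻¹) * ‖A x + G x‖
    refine max_le ?_ ?_ <;> nlinarith [norm_nonneg (A x + G x)]
  have hdense : g.range.topologicalClosure = ⊤ := by
    rw [Submodule.topologicalClosure_eq_top_iff, Submodule.eq_bot_iff]
    intro w hw
    have hw' : ∀ x : A.domain, inner ℂ w (A x + G x) = 0 := fun x =>
      Submodule.inner_left_of_mem_orthogonal (LinearMap.mem_range.2 ⟨_, hg x⟩) hw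
    have hwd := hA.mem_domain_of_orthogonal
      (fun x => (mul_nonneg hc.le (sq_nonneg _)).trans (hG x)) hw'
    have h := hA.isDissipative.im_inner_add_nonneg hG ⟨w, hwd⟩
    rw [hw' ⟨w, hwd⟩, Complex.zero_im] at h
    have : ‖w‖ ^ 2 ≤ 0 := nonpos_of_mul_nonpos_right h hc
    exact norm_eq_zero.1 (pow_eq_zero_iff two_ne_zero |>.1 (le_antisymm this (sq_nonneg _)))
  obtain ⟨p, hp⟩ := (g.bijective_iff_dense_range_and_antilipschitz.2 ⟨hdense, hanti⟩).2 v
  obtain ⟨x, rfl⟩ := hgraph p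
  exact ⟨x, (hg x).symm.trans hp⟩

/-- `A + G` has dense range when `A` is maximally dissipative, `G` is bounded and dissipative, and
`A + G` is injective. -/
lemma IsMaximallyDissipative.exists_norm_sub_lt {A : H →ₗ.[ℂ] H}
    (hA : IsMaximallyDissipative A) {G : H →L[ℂ] H} (hG : ∀ x, 0 ≤ (inner ℂ x (G x)).im)
    (hinj : ∀ x : A.domain, A x + G x = 0 → (x : H) = 0) (u : H) {r : ℝ} (hr : 0 < r) :
    ∃ y : A.domain, ‖u - (A y + G y)‖ < r := by
  let T : A.domain →ₗ[ℂ] H := A.toFun + (G : H →ₗ[ℂ] H).comp A.domain.subtype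
  have hT : ∀ x, T x = A x + G x := fun x => rfl
  have hdense : (LinearMap.range T).topologicalClosure = ⊤ := by
    rw [Submodule.topologicalClosure_eq_top_iff, Submodule.eq_bot_iff]
    intro w hw
    have hw' : ∀ x : A.domain, inner ℂ w (A x + G x) = 0 := fun x =>
      Submodule.inner_left_of_mem_orthogonal (LinearMap.mem_range.2 ⟨x, hT x⟩) hw
    have hwd := hA.mem_domain_of_orthogonal hG hw'
    refine hinj ⟨w, hwd⟩ ?_
    -- the dissipative form of `A + G` vanishes at `w`, so `(A + G) w` is orthogonal to the domain
    have hform : ∀ x : A.domain, ∀ c : ℝ,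
        0 ≤ c ^ 2 * (inner ℂ (x : H) (T x)).im + c * (inner ℂ (x : H) (T ⟨w, hwd⟩)).im := by
      intro x c
      have h := hA.isDissipative.im_inner_add_nonneg (G := G) (c := 0) (by simpa using hG)
        (⟨w, hwd⟩ + (c : ℂ) • x)
      rw [← hT, map_add, map_smul] at h
      have e1 := hw' x
      have e2 := hw' ⟨w, hwd⟩
      rw [← hT] at e1 e2
      simp only [Submodule.coe_add, Submodule.coe_smul, inner_add_left, inner_add_right,
        inner_smul_left, inner_smul_right, e1, e2] at h
      simp at h
      nlinarith
    have him : ∀ x : A.domain, (inner ℂ (x : H) (T ⟨w, hwd⟩)).im = 0 := by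
      intro x
      set a := (inner ℂ (x : H) (T x)).im
      set b := (inner ℂ (x : H) (T ⟨w, hwd⟩)).im
      have ha : 0 ≤ a := by
        have := hA.isDissipative.im_inner_add_nonneg (G := G) (c := 0) (by simpa using hG) x
        simpa [← hT] using this
      -- A choice of `c` making the quadratic negative unless `b = 0`; `a + 1` replaces `a`, which
      -- may vanish.
      have h := hform x (-b / (a + 1))
      have h' : (-b / (a + 1)) ^ 2 * a + -b / (a + 1) * b = -b ^ 2 / (a + 1) ^ 2 := by
        field_simp
        ring
      rw [h', neg_div, neg_nonneg] at h
      have : b ^ 2 ≤ 0 := by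
        by_contra! hb
        exact absurd h (not_le.2 (by positivity))
      exact pow_eq_zero_iff two_ne_zero |>.1 (le_antisymm this (sq_nonneg _))
    -- Density of the domain is not needed: solving `(A + G + i) x = T w` gives `‖x‖² ≤ Im ⟨x, T w⟩
    -- = 0`, so `x = 0` and `T w = 0`.
    obtain ⟨x, hx⟩ := hA.exists_apply_add_eq (c := 1) one_pos (im_inner_add_smul_I hG 1)
      (T ⟨w, hwd⟩)
    have h := hA.isDissipative.im_inner_add_nonneg (im_inner_add_smul_I hG 1) x
    rw [hx, him x, one_mul] at h
    have hx0 : (x : H) = 0 :=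
      norm_eq_zero.1 (pow_eq_zero_iff two_ne_zero |>.1 (le_antisymm h (sq_nonneg _)))
    have hx0' : x = 0 := Subtype.ext hx0
    rw [← hT, ← hx, hx0']
    simp
  have hu : u ∈ closure (LinearMap.range T : Set H) := by
    rw [← Submodule.topologicalClosure_coe, hdense]
    trivial
  obtain ⟨_, ⟨y, rfl⟩, hy⟩ := Metric.mem_closure_iff.1 hu r hr
  exact ⟨y, by rwa [dist_eq_norm] at hy⟩

/-- Regularized solutions converge to the solution of `(A + G) u = v`. -/
lemma IsMaximallyDissipative.tendsto_regularized {A : H →ₗ.[ℂ] H}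
    (hA : IsMaximallyDissipative A) {G : H →L[ℂ] H} (hG : ∀ x, 0 ≤ (inner ℂ x (G x)).im)
    (hinj : ∀ x : A.domain, A x + G x = 0 → (x : H) = 0) {v : H} {u₀ : A.domain}
    (hu₀ : A u₀ + G u₀ = v) {u : ℝ → A.domain}
    (hu : ∀ ε > 0, A (u ε) + (G + (ε * Complex.I) • ContinuousLinearMap.id ℂ H) (u ε) = v) :
    Tendsto (fun ε => (u ε : H)) (𝓝[>] 0) (𝓝 (u₀ : H)) := by
  rw [Metric.tendsto_nhds]
  intro r hr
  obtain ⟨y, hy⟩ := hA.exists_norm_sub_lt hG hinj (u₀ : H) (half_pos hr)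
  have hsmall : ∀ᶠ ε : ℝ in 𝓝[>] 0, 2 * ‖(y : H)‖ * ε < r / 2 := by
    have : Tendsto (fun ε : ℝ => 2 * ‖(y : H)‖ * ε) (𝓝[>] 0) (𝓝 (2 * ‖(y : H)‖ * 0)) :=
      (tendsto_id.mono_left nhdsWithin_le_nhds).const_mul _
    rw [mul_zero] at this
    exact this.eventually_lt_const (half_pos hr)
  filter_upwards [hsmall, self_mem_nhdsWithin] with ε hε (hpos : 0 < ε)
  -- The corrector `iε y`, with `(A + G) y` close to `u₀`, nearly cancels the residual `-iε u₀`.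
  -- What remains is `ε` times a small vector, which absorbs the factor `1 / ε` of the resolvent
  -- estimate.
  let e : A.domain := u ε - u₀ + (ε * Complex.I) • y
  have he : A e + (G + (ε * Complex.I) • ContinuousLinearMap.id ℂ H) e =
      (-(ε * Complex.I)) • ((u₀ : H) - (A y + G y)) + (ε * Complex.I) ^ 2 • (y : H) := by
    have h1 := hu ε hpos
    simp only [add_apply, smul_apply,
      ContinuousLinearMap.id_apply] at h1 ⊢
    have h2 : A (u ε) = v - G (u ε) - (ε * Complex.I) • (u ε : H) := by rw [← h1]; abel
    have h3 : A u₀ = v - G u₀ := by rw [← hu₀]; abel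
    simp only [e, map_add, LinearPMap.map_add, LinearPMap.map_sub, LinearPMap.map_smul,
      Submodule.coe_add, Submodule.coe_sub, Submodule.coe_smul, map_sub, map_smul, h2, h3]
    module
  have hbound := hA.isDissipative.norm_le (im_inner_add_smul_I hG ε) e
  rw [he] at hbound
  have hnorm : ‖(ε * Complex.I : ℂ)‖ = ε := by simp [abs_of_pos hpos]
  have h4 : ε * ‖(e : H)‖ ≤ ε * (‖(u₀ : H) - (A y + G y)‖ + ε * ‖(y : H)‖) := by
    refine hbound.trans ((norm_add_le _ _).trans (le_of_eq ?_))
    rw [norm_smul, norm_smul, norm_neg, norm_pow, hnorm]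
    ring
  have h5 := le_of_mul_le_mul_left h4 hpos
  have h6 : (u ε : H) - u₀ = (e : H) - (ε * Complex.I) • (y : H) := by
    simp only [e, Submodule.coe_add, Submodule.coe_sub, Submodule.coe_smul]
    abel
  rw [dist_eq_norm, h6]
  refine (norm_sub_le _ _).trans_lt ?_
  rw [norm_smul, hnorm]
  linarith

end Dissipative

end SpectralAveraging

namespace SpectralAveraging

open Filter Topology

/-! ### Averaging for the regularized operators and removal of the regularization -/

section Averaging

variable {H : Type*} [NormedAddCommGroup H] [InnerProductSpace ℂ H]

lemma perturbed_apply (A : H →ₗ.[ℂ] H) (B : H →L[ℂ] H) (l t : ℝ) (x : A.domain) :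
    perturbed A B l t x = A x + (((t : ℂ) + l * Complex.I) • B) x := by
  have h : perturbed A B l t x = ((t : ℂ) • B + (Complex.I * (l : ℂ)) • B) (x : H) + A x := rfl
  rw [h, ← add_smul, add_comm, mul_comm Complex.I]

lemma exists_eq_inverse_apply {A : H →ₗ.[ℂ] H} {B : H →L[ℂ] H} {l t : ℝ}
    (hinj : LinearMap.ker (perturbed A B l t).toFun = ⊥) {v : H}
    (hv : v ∈ (perturbed A B l t).inverse.domain) :
    ∃ x : A.domain, A x + (((t : ℂ) + l * Complex.I) • B) x = v ∧
      inverseElement (perturbed A B l t) v hv = inner ℂ v (x : H) := by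
  obtain ⟨x, hx⟩ : v ∈ LinearMap.range (perturbed A B l t).toFun := by
    rwa [← LinearPMap.inverse_domain]
  refine ⟨x, (perturbed_apply A B l t x).symm.trans hx, ?_⟩
  rw [inverseElement, LinearPMap.inverse_apply_eq hinj (y := ⟨v, hv⟩) (x := x) hx]

lemma injective_of_ker_perturbed {A : H →ₗ.[ℂ] H} {B : H →L[ℂ] H} {l t : ℝ}
    (hinj : LinearMap.ker (perturbed A B l t).toFun = ⊥) (x : A.domain)
    (hx : A x + (((t : ℂ) + l * Complex.I) • B) x = 0) : (x : H) = 0 := by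
  have h : (perturbed A B l t).toFun x = 0 := (perturbed_apply A B l t x).trans hx
  have h' := LinearMap.ker_eq_bot'.1 hinj x h
  exact congrArg Subtype.val h'

variable [CompleteSpace H]

lemma sqrt_apply_sqrt_apply {B : H →L[ℂ] H} (hB : B.IsPositive) (x : H) :
    CFC.sqrt B (CFC.sqrt B x) = B x := by
  have h := CFC.sqrt_mul_sqrt_self B ((ContinuousLinearMap.nonneg_iff_isPositive B).2 hB)
  exact congrArg (fun T : H →L[ℂ] H => T x) h

lemma inner_sqrt_apply (B : H →L[ℂ] H) (x y : H) :
    inner ℂ x (CFC.sqrt B y) = inner ℂ (CFC.sqrt B x) y := by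
  have h := ((ContinuousLinearMap.nonneg_iff_isPositive _).1 (CFC.sqrt_nonneg B)).isSelfAdjoint
  rw [← ContinuousLinearMap.isSelfAdjoint_iff'.1 h, ContinuousLinearMap.adjoint_inner_right,
    ContinuousLinearMap.isSelfAdjoint_iff'.1 h]

lemma inner_apply_eq_norm_sqrt_sq {B : H →L[ℂ] H} (hB : B.IsPositive) (x : H) :
    inner ℂ x (B x) = ((‖CFC.sqrt B x‖ ^ 2 : ℝ) : ℂ) := by
  rw [← sqrt_apply_sqrt_apply hB, inner_sqrt_apply, inner_self_eq_norm_sq_to_K]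
  push_cast
  rfl

lemma im_inner_smul_apply {B : H →L[ℂ] H} (hB : B.IsPositive) (z : ℂ) (x : H) :
    (inner ℂ x ((z • B) x)).im = z.im * ‖CFC.sqrt B x‖ ^ 2 := by
  rw [smul_apply, inner_smul_right, inner_apply_eq_norm_sqrt_sq hB, Complex.im_mul_ofReal]

lemma im_inner_smul_apply_nonneg {B : H →L[ℂ] H} (hB : B.IsPositive) {z : ℂ} (hz : 0 ≤ z.im)
    (x : H) : 0 ≤ (inner ℂ x ((z • B) x)).im := by
  rw [im_inner_smul_apply hB]
  positivity

/-- The solution map `z ↦ (A + z B + i ε)⁻¹ v` is holomorphic on the closed upper half-plane. -/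
lemma IsMaximallyDissipative.differentiableOn_solution {A : H →ₗ.[ℂ] H}
    (hA : IsMaximallyDissipative A) {B : H →L[ℂ] H} (hB : B.IsPositive) {ε : ℝ} (hε : 0 < ε)
    {v : H} {u : ℂ → A.domain} (hu : ∀ z : ℂ, 0 ≤ z.im →
      A (u z) + (z • B + (ε * Complex.I) • ContinuousLinearMap.id ℂ H) (u z) = v) :
    DifferentiableOn ℂ (fun z => (u z : H)) {z | 0 ≤ z.im} := by
  have hG : ∀ z : ℂ, 0 ≤ z.im → ∀ x,
      ε * ‖x‖ ^ 2 ≤ (inner ℂ x ((z • B + (ε * Complex.I) • ContinuousLinearMap.id ℂ H) x)).im :=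
    fun z hz => im_inner_add_smul_I (im_inner_smul_apply_nonneg hB hz) ε
  intro w (hw : 0 ≤ w.im)
  -- `p` is the derivative: differentiating `(A + zB + iε) u = v` formally gives `(A + wB + iε) u' =
  -- -B u`.
  obtain ⟨p, hp⟩ := hA.exists_apply_add_eq hε (hG w hw) (-(B (u w)))
  suffices HasDerivWithinAt (fun z => (u z : H)) (p : H) {z | 0 ≤ z.im} w from
    this.differentiableWithinAt
  rw [hasDerivWithinAt_iff_isLittleO]
  refine Asymptotics.IsBigO.trans_isLittleO (g := fun z => ‖z - w‖ ^ 2) ?_ ?_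
  · refine Asymptotics.IsBigO.of_bound (‖B p‖ / ε) ?_
    filter_upwards [self_mem_nhdsWithin] with z (hz : 0 ≤ z.im)
    let e : A.domain := u z - u w - (z - w) • p
    have he : A e + (z • B + (ε * Complex.I) • ContinuousLinearMap.id ℂ H) e =
        -((z - w) ^ 2 • B p) := by
      have h1 := hu z hz
      have h2 := hu w hw
      simp only [add_apply, smul_apply, ContinuousLinearMap.id_apply] at h1 h2 hp ⊢
      have h1' : A (u z) = v - (z • B (u z) + (ε * Complex.I) • (u z : H)) := eq_sub_of_add_eq h1
      have h2' : A (u w) = v - (w • B (u w) + (ε * Complex.I) • (u w : H)) := eq_sub_of_add_eq h2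
      have h3' : A p = -B (u w) - (w • B p + (ε * Complex.I) • (p : H)) := eq_sub_of_add_eq hp
      simp only [e, LinearPMap.map_sub, LinearPMap.map_smul, Submodule.coe_sub,
        Submodule.coe_smul, map_sub, map_smul, h1', h2', h3']
      module
    have hb := hA.isDissipative.norm_le (hG z hz) e
    rw [he, norm_neg, norm_smul, norm_pow] at hb
    change ‖(e : H)‖ ≤ _
    rw [norm_pow, norm_norm, div_mul_eq_mul_div, le_div_iff₀ hε]
    linarith
  · have : Tendsto (fun z : ℂ => ‖z - w‖) (𝓝[{z | 0 ≤ z.im}] w) (𝓝 0) := by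
      have h : Continuous fun z : ℂ => ‖z - w‖ := by fun_prop
      simpa using (h.tendsto w).mono_left nhdsWithin_le_nhds
    have h := (Asymptotics.isLittleO_one_iff ℝ).2 this |>.mul_isBigO
      (Asymptotics.isBigO_refl (fun z : ℂ => ‖z - w‖) _)
    simp only [one_mul, ← pow_two] at h
    exact Asymptotics.isLittleO_norm_right.1 h

/-- `sum_im_le` applies to `z ↦ -⟨v, u z⟩`. Its sup bound `‖v‖² / ε` blows up as `ε → 0`, but the
mass bound `K = ‖φ‖²` does not involve `ε`, and only `K` enters the conclusion. -/
lemma sum_im_solution_le {A : H →ₗ.[ℂ] H}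
    (hA : IsMaximallyDissipative A) {B : H →L[ℂ] H} (hB : B.IsPositive) {ε l : ℝ} (hε : 0 < ε)
    (hl : 0 < l) {φ : H} {u : ℂ → A.domain} (hu : ∀ z : ℂ, 0 ≤ z.im →
      A (u z) + (z • B + (ε * Complex.I) • ContinuousLinearMap.id ℂ H) (u z) = CFC.sqrt B φ)
    (S : Finset ℤ) (t : ℤ → ℝ) (ht : ∀ n : ℤ, t n ∈ Set.Icc (n : ℝ) (n + 1)) :
    ∑ n ∈ S, -(inner ℂ (CFC.sqrt B φ) (u (t n + l * Complex.I) : H)).im ≤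
      (Real.pi + 3 / l) * ‖φ‖ ^ 2 := by
  set v := CFC.sqrt B φ with hv
  have hG : ∀ z : ℂ, 0 ≤ z.im → ∀ x,
      ε * ‖x‖ ^ 2 ≤ (inner ℂ x ((z • B + (ε * Complex.I) • ContinuousLinearMap.id ℂ H) x)).im :=
    fun z hz => im_inner_add_smul_I (im_inner_smul_apply_nonneg hB hz) ε
  have hsymm : ∀ x : H, (-inner ℂ v x).im = (inner ℂ x v).im := fun x => by
    rw [← inner_conj_symm, Complex.neg_im, Complex.conj_im, neg_neg]
  refine sum_im_le (f := fun z => -inner ℂ v (u z : H)) (M := ‖v‖ * (‖v‖ / ε)) hl ?_ ?_ ?_ ?_ S t ht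
  · exact ((innerSL ℂ v).differentiable.comp_differentiableOn
      (hA.differentiableOn_solution hB hε hu)).neg
  · intro z hz
    have h := hA.isDissipative.norm_le (hG z hz) (u z)
    rw [hu z hz, mul_comm, ← le_div_iff₀ hε] at h
    rw [norm_neg]
    exact (norm_inner_le_norm _ _).trans (by gcongr)
  · intro z hz
    have h := hA.isDissipative.im_inner_add_nonneg (hG z hz) (u z)
    rw [hu z hz] at h
    rw [hsymm]
    exact le_trans (by positivity) h
  · intro y hy
    have hz : 0 ≤ (y * Complex.I : ℂ).im := by simpa using hy.le
    set x := u (y * Complex.I) with hx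
    have h1 : y * ‖CFC.sqrt B x‖ ^ 2 ≤ (inner ℂ (x : H) v).im := by
      rw [← hu _ hz, ← hx, inner_add_right, add_apply, inner_add_right, Complex.add_im,
        Complex.add_im, im_inner_smul_apply hB]
      have h2 := hA.isDissipative x
      have h3 := im_inner_add_smul_I (G := (0 : H →L[ℂ] H)) (by simp) ε x
      rw [zero_add] at h3
      have h4 : 0 ≤ ε * ‖(x : H)‖ ^ 2 := by positivity
      have h5 : (y * Complex.I : ℂ).im = y := by simp
      rw [h5]
      linarith
    have h2 : (inner ℂ (x : H) v).im ≤ ‖CFC.sqrt B x‖ * ‖φ‖ := by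
      rw [hv, inner_sqrt_apply]
      exact (Complex.im_le_norm _).trans (norm_inner_le_norm _ _)
    -- With `b = ‖B^{1/2} x‖` and `J = Im ⟨x, v⟩`, the bounds `y b² ≤ J ≤ b‖φ‖` inserted in `0 ≤ (y
    -- b - ‖φ‖)²` give `y J ≤ ‖φ‖²`.
    rw [hsymm, le_div_iff₀ hy]
    nlinarith [sq_nonneg (y * ‖CFC.sqrt B x‖ - ‖φ‖), norm_nonneg φ, norm_nonneg (CFC.sqrt B x),
      sq_nonneg (‖φ‖ - y * ‖CFC.sqrt B x‖), mul_le_mul_of_nonneg_left h1 hy.le,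
      mul_le_mul_of_nonneg_left h2 hy.le]

/-- The imaginary part of the matrix element of a dissipative inverse is nonpositive. -/
lemma inverseElement_im_nonpos {A : H →ₗ.[ℂ] H} (hA : IsDissipative A)
    {B : H →L[ℂ] H} (hB : B.IsPositive) {l t : ℝ} (hl : 0 ≤ l)
    (hinj : LinearMap.ker (perturbed A B l t).toFun = ⊥) {v : H}
    (hv : v ∈ (perturbed A B l t).inverse.domain) :
    (inverseElement (perturbed A B l t) v hv).im ≤ 0 := by
  obtain ⟨x, hx, h⟩ := exists_eq_inverse_apply hinj hv
  have hz : 0 ≤ ((t : ℂ) + l * Complex.I).im := by simpa using hl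
  have h1 := hA.im_inner_add_nonneg (c := 0)
    (fun y => by rw [zero_mul]; exact im_inner_smul_apply_nonneg hB hz y) x
  rw [hx, zero_mul, ← inner_conj_symm, Complex.conj_im] at h1
  rw [h]
  linarith

/-- Spectral averaging over finitely many points, one in each unit interval. -/
lemma sum_inverseElement_le {A : H →ₗ.[ℂ] H} (hA : IsMaximallyDissipative A)
    {B : H →L[ℂ] H} (hB : B.IsPositive) {l : ℝ} (hl : 0 < l) {φ : H}
    (hinj : ∀ t : ℝ, LinearMap.ker (perturbed A B l t).toFun = ⊥)
    (hdom : ∀ t : ℝ, CFC.sqrt B φ ∈ (perturbed A B l t).inverse.domain)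
    (S : Finset ℤ) (t : ℤ → ℝ) (ht : ∀ n : ℤ, t n ∈ Set.Icc (n : ℝ) (n + 1)) :
    ∑ n ∈ S, -(inverseElement (perturbed A B l (t n)) (CFC.sqrt B φ) (hdom (t n))).im ≤
      Real.pi * (1 + 1 / l) * ‖φ‖ ^ 2 := by
  -- Solutions are chosen for all `ε` and `z`, with the value `0` where `ε ≤ 0` or `z.im < 0`.
  have hu : ∀ ε : ℝ, ∃ u : ℂ → A.domain, 0 < ε → ∀ z : ℂ, 0 ≤ z.im →
      A (u z) + (z • B + (ε * Complex.I) • ContinuousLinearMap.id ℂ H) (u z) = CFC.sqrt B φ := by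
    intro ε
    by_cases hε : 0 < ε
    · have hz : ∀ z : ℂ, ∃ x : A.domain, 0 ≤ z.im →
          A x + (z • B + (ε * Complex.I) • ContinuousLinearMap.id ℂ H) x = CFC.sqrt B φ := by
        intro z
        by_cases hz : 0 ≤ z.im
        · obtain ⟨x, hx⟩ := hA.exists_apply_add_eq hε
            (im_inner_add_smul_I (im_inner_smul_apply_nonneg hB hz) ε) (CFC.sqrt B φ)
          exact ⟨x, fun _ => hx⟩
        · exact ⟨0, fun h => absurd h hz⟩
      choose u hu using hz
      exact ⟨u, fun _ => hu⟩
    · exact ⟨0, fun h => absurd h hε⟩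
  choose u hu using hu
  have hlim : ∀ n, Tendsto (fun ε => -(inner ℂ (CFC.sqrt B φ)
      (u ε (t n + l * Complex.I) : H)).im) (𝓝[>] 0)
      (𝓝 (-(inverseElement (perturbed A B l (t n)) (CFC.sqrt B φ) (hdom (t n))).im)) := by
    intro n
    obtain ⟨x, hx, h⟩ := exists_eq_inverse_apply (hinj (t n)) (hdom (t n))
    have hz : 0 ≤ ((t n : ℂ) + l * Complex.I).im := by simpa using hl.le
    have hconv := hA.tendsto_regularized (im_inner_smul_apply_nonneg hB hz)
      (injective_of_ker_perturbed (hinj (t n))) hx (u := fun ε => u ε (t n + l * Complex.I))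
      fun ε hε => hu ε hε _ hz
    rw [h]
    exact ((Complex.continuous_im.tendsto _).comp (tendsto_const_nhds.inner hconv)).neg
  have hle : ∑ n ∈ S, -(inverseElement (perturbed A B l (t n)) (CFC.sqrt B φ) (hdom (t n))).im ≤
      (Real.pi + 3 / l) * ‖φ‖ ^ 2 :=
    le_of_tendsto (tendsto_finsetSum S fun n _ => hlim n)
      (by
        filter_upwards [self_mem_nhdsWithin] with ε (hε : 0 < ε)
        exact sum_im_solution_le hA hB hε hl (hu ε hε) S t ht)
  refine hle.trans ?_
  gcongr
  -- The stated constant comes from `3 ≤ π`.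
  rw [mul_add, mul_one, mul_one_div]
  gcongr
  exact Real.pi_gt_three.le

/-! ### From finite sums over sample points to series of suprema -/

/-- If all sums of values of nonnegative functions, with one argument for each index, are bounded,
then so is the sum of the suprema. -/
lemma tsum_ciSup_le {ι Y : Type*} [Nonempty Y] {f : ι → Y → ℝ} {C : ℝ}
    (h0 : ∀ n y, 0 ≤ f n y) (h : ∀ (S : Finset ι) (y : ι → Y), ∑ n ∈ S, f n (y n) ≤ C) :
    (∀ n, BddAbove (Set.range (f n))) ∧ Summable (fun n => ⨆ y, f n y) ∧
      ∑' n, ⨆ y, f n y ≤ C := by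
  have hbdd : ∀ n, BddAbove (Set.range (f n)) := fun n =>
    ⟨C, by rintro _ ⟨y, rfl⟩; simpa using h {n} fun _ => y⟩
  have hnn : 0 ≤ fun n => ⨆ y, f n y := fun n => Real.iSup_nonneg (h0 n)
  have hsum : ∀ S : Finset ι, ∑ n ∈ S, ⨆ y, f n y ≤ C := by
    intro S
    refine le_of_forall_pos_le_add fun δ hδ => ?_
    -- Each near-maximizer may lose this much, for a total below `δ`; the `+ 1` covers empty `S`.
    have hδ' : 0 < δ / (S.card + 1) := by positivity
    choose y hy using fun n => exists_lt_of_lt_ciSup (sub_lt_self (⨆ y, f n y) hδ')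
    calc ∑ n ∈ S, ⨆ y, f n y ≤ ∑ n ∈ S, (f n (y n) + δ / (S.card + 1)) :=
          Finset.sum_le_sum fun n _ => by linarith [hy n]
      _ = ∑ n ∈ S, f n (y n) + S.card * (δ / (S.card + 1)) := by
          rw [Finset.sum_add_distrib, Finset.sum_const, nsmul_eq_mul]
      _ ≤ C + δ := by
          refine add_le_add (h S y) ?_
          rw [mul_div_assoc', div_le_iff₀ (by positivity)]
          nlinarith
  exact ⟨hbdd, summable_of_sum_le hnn hsum, Real.tsum_le_of_sum_le hnn hsum⟩

end Averaging

end SpectralAveraging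

theorem mainTheorem7 {H : Type*} [NormedAddCommGroup H] [InnerProductSpace ℂ H]
    [CompleteSpace H] [TopologicalSpace.SeparableSpace H]
    (A : H →ₗ.[ℂ] H) (hA : SpectralAveraging.IsMaximallyDissipative A)
    (B : H →L[ℂ] H) (hB : B.IsPositive) (l : ℝ) (hl : 0 < l) (φ : H)
    -- the inverse of `A + t B + i l B` exists, and `B^{1/2} φ` is in its domain
    (hinj : ∀ t : ℝ, LinearMap.ker (SpectralAveraging.perturbed A B l t).toFun = ⊥)
    (hdom : ∀ t : ℝ,
      CFC.sqrt B φ ∈ (SpectralAveraging.perturbed A B l t).inverse.domain) :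
    ((∀ n : ℤ, BddAbove (Set.range fun y : Set.Icc (0 : ℝ) 1 =>
        -(SpectralAveraging.inverseElement (SpectralAveraging.perturbed A B l (n + y))
          (CFC.sqrt B φ) (hdom (n + y))).im)) ∧
      Summable (fun n : ℤ => ⨆ y : Set.Icc (0 : ℝ) 1,
        -(SpectralAveraging.inverseElement (SpectralAveraging.perturbed A B l (n + y))
          (CFC.sqrt B φ) (hdom (n + y))).im) ∧
      ∑' n : ℤ, ⨆ y : Set.Icc (0 : ℝ) 1,
        -(SpectralAveraging.inverseElement (SpectralAveraging.perturbed A B l (n + y))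
          (CFC.sqrt B φ) (hdom (n + y))).im
        ≤ Real.pi * (1 + 1 / l) * ‖φ‖ ^ 2) ∧
    ((∀ n : ℤ, BddAbove (Set.range fun y : Set.Icc (0 : ℝ) 1 =>
        (SpectralAveraging.inverseElement (SpectralAveraging.perturbed A B l (n + y))
          (CFC.sqrt B φ) (hdom (n + y))).im)) ∧
      Summable (fun n : ℤ => ⨆ y : Set.Icc (0 : ℝ) 1,
        (SpectralAveraging.inverseElement (SpectralAveraging.perturbed A B l (n + y))
          (CFC.sqrt B φ) (hdom (n + y))).im) ∧
      -(∑' n : ℤ, ⨆ y : Set.Icc (0 : ℝ) 1,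
        (SpectralAveraging.inverseElement (SpectralAveraging.perturbed A B l (n + y))
          (CFC.sqrt B φ) (hdom (n + y))).im)
        ≤ Real.pi * (1 + 1 / l) * ‖φ‖ ^ 2) := by
  have hnonpos : ∀ t : ℝ, (SpectralAveraging.inverseElement
      (SpectralAveraging.perturbed A B l t) (CFC.sqrt B φ) (hdom t)).im ≤ 0 := fun t =>
    SpectralAveraging.inverseElement_im_nonpos hA.isDissipative hB hl.le (hinj t) (hdom t)
  have hY : ∀ (n : ℤ) (y : Set.Icc (0 : ℝ) 1), (n : ℝ) + y ∈ Set.Icc (n : ℝ) (n + 1) :=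
    fun n y => ⟨by linarith [y.2.1], by linarith [y.2.2]⟩
  have hsum : ∀ (S : Finset ℤ) (y : ℤ → Set.Icc (0 : ℝ) 1),
      ∑ n ∈ S, -(SpectralAveraging.inverseElement (SpectralAveraging.perturbed A B l (n + y n))
        (CFC.sqrt B φ) (hdom (n + y n))).im ≤ Real.pi * (1 + 1 / l) * ‖φ‖ ^ 2 := fun S y =>
    SpectralAveraging.sum_inverseElement_le hA hB hl hinj hdom S (fun n => n + y n)
      fun n => hY n (y n)
  have hfst := SpectralAveraging.tsum_ciSup_le
    (f := fun (n : ℤ) (y : Set.Icc (0 : ℝ) 1) => -(SpectralAveraging.inverseElement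
      (SpectralAveraging.perturbed A B l (n + y)) (CFC.sqrt B φ) (hdom (n + y))).im)
    (fun n y => neg_nonneg.2 (hnonpos _)) hsum
  refine ⟨hfst, ?_⟩
  have hbdd : ∀ n : ℤ, BddAbove (Set.range fun y : Set.Icc (0 : ℝ) 1 =>
      (SpectralAveraging.inverseElement (SpectralAveraging.perturbed A B l (n + y))
        (CFC.sqrt B φ) (hdom (n + y))).im) := fun n =>
    ⟨0, by rintro _ ⟨y, rfl⟩; exact hnonpos _⟩
  have hneg : 0 ≤ fun n : ℤ => -⨆ y : Set.Icc (0 : ℝ) 1,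
      (SpectralAveraging.inverseElement (SpectralAveraging.perturbed A B l (n + y))
        (CFC.sqrt B φ) (hdom (n + y))).im := fun n =>
    neg_nonneg.2 (ciSup_le fun y => hnonpos _)
  -- Here minus the supremum is an infimum of nonnegative numbers, so the single sample `y = 0` in
  -- each cell suffices.
  have hle : ∀ S : Finset ℤ, ∑ n ∈ S, -⨆ y : Set.Icc (0 : ℝ) 1,
      (SpectralAveraging.inverseElement (SpectralAveraging.perturbed A B l (n + y))
        (CFC.sqrt B φ) (hdom (n + y))).im ≤ Real.pi * (1 + 1 / l) * ‖φ‖ ^ 2 := fun S =>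
    (Finset.sum_le_sum fun n _ => neg_le_neg (le_ciSup (hbdd n) 0)).trans (hsum S fun _ => 0)
  exact ⟨hbdd, summable_neg_iff.1 (summable_of_sum_le hneg hle), by
    rw [← tsum_neg]
    exact Real.tsum_le_of_sum_le hneg hle⟩
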